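/- Let $T>0$, let $\varphi:\mathbb{R}^n\times[0,T]\to\mathbb{R}$, $h:\mathbb{R}^n\times[0,T]\to\mathbb{R}^p$, $g:\mathbb{R}^n\times[0,T]\to\mathbb{R}^m$ be given, and consider the continuous-time program $$\text{(CTP)}\qquad \text{minimize } P(x)=\int_0^T\varphi(x(t),t)\,dt\quad\text{subject to } h(x(t),t)=0,\ g(x(t),t)\le 0 \text{ (componentwise) for a.e. } t\in[0,T],\quad x\in L^\infty([0,T];\mathbb{R}^n).$$ Let $\Omega$ be its feasible set. A point $\bar x\in\Omega$ is a local optimal solution if there is $\rho>0$ such that $P(\bar x)\le P(x)$ for every $x\in\Omega$ with $\|x(t)-\bar x(t)\|<\rho$ for a.e. $t\in[0,T]$ (only those $x$ for which the integral $P(x)$ exists being compared). Write $\bar B_r(t)=\{y\in\mathbb{R}^n:\|y-\bar x(t)\|\le r\}$. Let $\bar x$ be a local optimal solution of (CTP), and suppose that there is $r>0$ such that the following hold. (H1) $\varphi(\cdot,t)$ is continuously differentiable for a.e. $t$; $\varphi(x,\cdot)$ is Lebesgue measurable for each $x$; $|\varphi(\bar x(\cdot),\cdot)|$ is integrable on $[0,T]$;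 and there is an integrable function $c_\varphi$ on $[0,T]$ with $|\varphi(x,t)-\varphi(y,t)|\le c_\varphi(t)\|x-y\|$ for all $x,y\in\bar B_r(t)$, for a.e. $t\in[0,T]$. (H2) $(h,g)(\cdot,t)$ is continuously differentiable for a.e. $t$; $(h,g)(x,\cdot)$ is Lebesgue measurable for each $x$; $\|(h,g)(\bar x(\cdot),\cdot)\|$ is integrable on $[0,T]$; and there is an integrable function $c_{h,g}$ on $[0,T]$ with $\|(h,g)(x,t)-(h,g)(y,t)\|\le c_{h,g}(t)\|x-y\|$ for all $x,y\in\bar B_r(t)$, for a.e. $t\in[0,T]$. Then $\bar x$ is a pointwise asymptotic KKT (pw-AKKT) solution of (CTP). That is, with $L(x,u,v,t)=\varphi(x,t)+\sum_{i=1}^p u_ih_i(x,t)+\sum_{j=1}^m v_jg_j(x,t)$ and $g_j^-=\max\{-g_j,0\}$, there is a sequence $(x^k,u^k,v^k)_{k\in\mathbb{N}}$ in $L^\infty([0,T];\mathbb{R}^n\times\mathbb{R}^p\times\mathbb{R}^m)$ such that: 1. $x^k(t)\to\bar x(t)$ for a.e. $t\in[0,T]$; 2. for every $k$ the function $t\mapsto\nabla_xL(x^k(t),u^k(t),v^k(t),t)$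 is integrable on $[0,T]$, and for every $\gamma\in L^\infty([0,T];\mathbb{R}^n)$ $$\int_0^T\nabla_xL(x^k(t),u^k(t),v^k(t),t)\cdot\gamma(t)\,dt\to0\quad(k\to\infty);$$ 3. $v_j^k(t)\,g_j^-(x^k(t),t)\to0$ for a.e. $t\in[0,T]$, for $j=1,\dots,m$; 4. $v_j^k(t)\ge0$ for a.e. $t\in[0,T]$, for all $k$ and $j=1,\dots,m$. No constraint qualification is assumed. -/

import Mathlib

open MeasureTheory Filter Topology

/-- Data of a continuous-time programming problem on `[0,T]`: minimize `∫₀ᵀ φ(x(t),t) dt` subject to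
`h(x(t),t) = 0`, `g(x(t),t) ≤ 0` a.e. on `[0,T]`, over `x ∈ L^∞([0,T];ℝⁿ)`.
Only the values at times `t ∈ [0,T]` matter. -/
structure CTProblem (n p m : ℕ) where
  T : ℝ
  T_pos : 0 < T
  φ : EuclideanSpace ℝ (Fin n) → ℝ → ℝ
  h : EuclideanSpace ℝ (Fin n) → ℝ → EuclideanSpace ℝ (Fin p)
  g : EuclideanSpace ℝ (Fin n) → ℝ → EuclideanSpace ℝ (Fin m)

namespace CTProblem

variable {n p m : ℕ}

/-- Lebesgue measure on `[0,T]`. -/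
noncomputable def μ (C : CTProblem n p m) : Measure ℝ :=
  volume.restrict (Set.Icc 0 C.T)

/-- The map `(h,g)` with values in `ℝᵖ × ℝᵐ`, which carries the Euclidean norm. -/
noncomputable def hg (C : CTProblem n p m) (x : EuclideanSpace ℝ (Fin n)) (t : ℝ) :
    WithLp 2 (EuclideanSpace ℝ (Fin p) × EuclideanSpace ℝ (Fin m)) :=
  WithLp.toLp 2 (C.h x t, C.g x t)

/-- The cost `P(x) = ∫₀ᵀ φ(x(t),t) dt`. -/
noncomputable def cost (C : CTProblem n p m) (x : ℝ → EuclideanSpace ℝ (Fin n)) : ℝ :=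
  ∫ t, C.φ (x t) t ∂C.μ

/-- The feasible set `Ω`; elements of `L^∞` are represented by functions. -/
def feasible (C : CTProblem n p m) : Set (ℝ → EuclideanSpace ℝ (Fin n)) :=
  {x | MemLp x ⊤ C.μ ∧ (∀ᵐ t ∂C.μ, C.h (x t) t = 0) ∧ ∀ᵐ t ∂C.μ, ∀ j, C.g (x t) t j ≤ 0}

/-- Local optimal solutions. The cost of `x̄` is compared with that of the competitors whose cost
integral exists; under `H1` these are, for small `r`, all feasible `x` with `x(t) ∈ B_r(t)` a.e. -/
def IsLocalOptimal (C : CTProblem n p m) (xbar : ℝ → EuclideanSpace ℝ (Fin n)) : Prop :=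
  xbar ∈ C.feasible ∧ ∃ r : ℝ, 0 < r ∧ ∀ x ∈ C.feasible,
    (∀ᵐ t ∂C.μ, x t ∈ Metric.ball (xbar t) r) →
    Integrable (fun t => C.φ (x t) t) C.μ →
    C.cost xbar ≤ C.cost x

/-- Hypothesis (H1) at `x̄` with radius `r`. -/
structure H1 (C : CTProblem n p m) (xbar : ℝ → EuclideanSpace ℝ (Fin n)) (r : ℝ) : Prop where
  contDiff : ∀ᵐ t ∂C.μ, ContDiff ℝ 1 (fun x => C.φ x t)
  measurable : ∀ x, AEMeasurable (fun t => C.φ x t) C.μ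
  integrable : Integrable (fun t => |C.φ (xbar t) t|) C.μ
  lipschitz : ∃ c : ℝ → ℝ, Integrable c C.μ ∧ ∀ᵐ t ∂C.μ,
    ∀ x ∈ Metric.closedBall (xbar t) r, ∀ y ∈ Metric.closedBall (xbar t) r,
      |C.φ x t - C.φ y t| ≤ c t * ‖x - y‖

/-- Hypothesis (H2) at `x̄` with radius `r`. -/
structure H2 (C : CTProblem n p m) (xbar : ℝ → EuclideanSpace ℝ (Fin n)) (r : ℝ) : Prop where
  contDiff : ∀ᵐ t ∂C.μ, ContDiff ℝ 1 (fun x => C.hg x t)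
  measurable : ∀ x, AEMeasurable (fun t => C.hg x t) C.μ
  integrable : Integrable (fun t => ‖C.hg (xbar t) t‖) C.μ
  lipschitz : ∃ c : ℝ → ℝ, Integrable c C.μ ∧ ∀ᵐ t ∂C.μ,
    ∀ x ∈ Metric.closedBall (xbar t) r, ∀ y ∈ Metric.closedBall (xbar t) r,
      ‖C.hg x t - C.hg y t‖ ≤ c t * ‖x - y‖

/-- The Lagrangian `L(x,u,v,t) = φ(x,t) + ∑ uᵢ hᵢ(x,t) + ∑ vⱼ gⱼ(x,t)`. -/
noncomputable def lagrangian (C : CTProblem n p m) (x : EuclideanSpace ℝ (Fin n))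
    (u : EuclideanSpace ℝ (Fin p)) (v : EuclideanSpace ℝ (Fin m)) (t : ℝ) : ℝ :=
  C.φ x t + ∑ i, u i * C.h x t i + ∑ j, v j * C.g x t j

/-- The gradient `∇ₓL(x,u,v,t)`. -/
noncomputable def gradLagrangian (C : CTProblem n p m) (x : EuclideanSpace ℝ (Fin n))
    (u : EuclideanSpace ℝ (Fin p)) (v : EuclideanSpace ℝ (Fin m)) (t : ℝ) :
    EuclideanSpace ℝ (Fin n) :=
  gradient (fun y => C.lagrangian y u v t) x

/-- AKKT sequences `(xᵏ,uᵏ,vᵏ)`. The field `integrable` says that the integrals in `weak` exist. -/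
structure IsAKKTSeq (C : CTProblem n p m) (x : ℕ → ℝ → EuclideanSpace ℝ (Fin n))
    (u : ℕ → ℝ → EuclideanSpace ℝ (Fin p)) (v : ℕ → ℝ → EuclideanSpace ℝ (Fin m)) : Prop where
  memLp_x : ∀ k, MemLp (x k) ⊤ C.μ
  memLp_u : ∀ k, MemLp (u k) ⊤ C.μ
  memLp_v : ∀ k, MemLp (v k) ⊤ C.μ
  integrable : ∀ k, Integrable (fun t => C.gradLagrangian (x k t) (u k t) (v k t) t) C.μ
  weak : ∀ γ : ℝ → EuclideanSpace ℝ (Fin n), MemLp γ ⊤ C.μ →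
    Tendsto (fun k => ∫ t, inner ℝ (C.gradLagrangian (x k t) (u k t) (v k t) t) (γ t) ∂C.μ)
      atTop (𝓝 0)
  compl : ∀ j, ∀ᵐ t ∂C.μ,
    Tendsto (fun k => v k t j * max (-(C.g (x k t) t j)) 0) atTop (𝓝 0)
  nonneg : ∀ k j, ∀ᵐ t ∂C.μ, 0 ≤ v k t j

/-- Pointwise asymptotic KKT (pw-AKKT) solutions. -/
def IsPwAKKT (C : CTProblem n p m) (xbar : ℝ → EuclideanSpace ℝ (Fin n)) : Prop :=
  xbar ∈ C.feasible ∧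
    ∃ (x : ℕ → ℝ → EuclideanSpace ℝ (Fin n)) (u : ℕ → ℝ → EuclideanSpace ℝ (Fin p))
      (v : ℕ → ℝ → EuclideanSpace ℝ (Fin m)),
      C.IsAKKTSeq x u v ∧ ∀ᵐ t ∂C.μ, Tendsto (fun k => x k t) atTop (𝓝 (xbar t))

end CTProblem

/-! The constraints act separately at each time, so an `L^∞` local minimizer is a pointwise one: for
a.e. `t`, `xbar t` minimizes `φ(·,t)` over the admissible points of a ball of fixed radius.
Otherwise a measurable choice of better points on a set of positive measure, glued to `xbar`
elsewhere, would lower the cost (`CTProblem.measure_eq_zero_of_improving`,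
`CTProblem.IsLocalOptimal.ae_isMin`).

At each such `t` a quadratic penalty argument yields approximate KKT triples without any constraint
qualification (`exists_approximate_kkt`). Both measurable choices come from
`exists_measurable_selection_nonpos`, once the conditions are encoded in one Carathéodory inequality
`G y t ≤ 0`.

The selected multipliers need not be bounded. The `k`-th triple is therefore reset to `(xbar, 0, 0)`
on a set `B k` where they are large, the measures of these sets being summable. By Borel–Cantelli
a.e. `t` lies in only finitely many `B k`, so pointwise limits are unaffected. On `B k` the
Lagrangian gradient is that of `φ` at `xbar t`, bounded by the integrable Lipschitz constant, and
dominated convergence gives the weak limit. -/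

/-! ### Superposition with Carathéodory functions -/

section Caratheodory

variable {α E F : Type*} [MeasurableSpace α] {μ : Measure α}

/-- Superposition with a Carathéodory function preserves a.e.-measurability. -/
theorem aemeasurable_comp_of_continuous_left [PseudoMetricSpace E]
    [TopologicalSpace.SeparableSpace E] [MeasurableSpace E] [BorelSpace E]
    [TopologicalSpace F] [TopologicalSpace.PseudoMetrizableSpace F] [MeasurableSpace F]
    [BorelSpace F] {f : E → α → F} (hc : ∀ᵐ t ∂μ, Continuous fun x => f x t)
    (hm : ∀ x, AEMeasurable (f x) μ) {x : α → E} (hx : AEMeasurable x μ) :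
    AEMeasurable (fun t => f (x t) t) μ := by
  rcases isEmpty_or_nonempty E with hE | hE
  · have : IsEmpty α := ⟨fun t => hE.elim (x t)⟩
    exact (measurable_of_empty _).aemeasurable
  let d := TopologicalSpace.denseSeq E
  -- `nearestPt` takes values in the dense sequence, so this composite glues countably many
  -- functions `f (d n)`; continuity in the first variable gives the limit in `N`.
  have key : ∀ N, AEMeasurable (fun t => f (SimpleFunc.nearestPt d N (hx.mk x t)) t) μ := by
    intro N
    have hI : Measurable fun t => SimpleFunc.nearestPtInd d N (hx.mk x t) :=
      (SimpleFunc.measurable _).comp hx.measurable_mk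
    refine ⟨fun t => (hm (d (SimpleFunc.nearestPtInd d N (hx.mk x t)))).mk _ t, ?_, ?_⟩
    · have : Measurable fun z : ℕ × α => (hm (d z.1)).mk _ z.2 :=
        measurable_from_prod_countable_right fun n => (hm (d n)).measurable_mk
      exact this.comp (hI.prodMk measurable_id)
    · filter_upwards [ae_all_iff.2 fun n => (hm (d n)).ae_eq_mk] with t ht
      exact ht _
  refine aemeasurable_of_tendsto_metrizable_ae atTop key ?_
  filter_upwards [hc, hx.ae_eq_mk] with t ht hxt
  rw [hxt]
  exact (ht.tendsto _).comp
    (SimpleFunc.tendsto_nearestPt (TopologicalSpace.denseRange_denseSeq E _))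

end Caratheodory

/-! ### Measurable selection -/

section Selection

variable {α E : Type*} [MeasurableSpace α] {μ : Measure α}

/-- Compactness of closed balls trades an uncountable quantifier for countable ones over a dense
sequence, with vanishing slack. This is what makes the set of solvable times null-measurable. -/
theorem exists_mem_closedBall_nonpos_iff [MetricSpace E] [ProperSpace E] [Nonempty E] {F : E → ℝ}
    (hF : Continuous F) (q : E) (s : ℝ) :
    (∃ y ∈ Metric.closedBall q s, F y ≤ 0) ↔
      ∀ k : ℕ, ∃ n : ℕ, dist (TopologicalSpace.denseSeq E n) q < s + 1 / ((k : ℝ) + 1) ∧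
        F (TopologicalSpace.denseSeq E n) < 1 / ((k : ℝ) + 1) := by
  constructor
  · rintro ⟨y, hy, hFy⟩ k
    have hk : (0 : ℝ) < 1 / ((k : ℝ) + 1) := Nat.one_div_pos_of_nat
    have hU : IsOpen {z | dist z q < s + 1 / ((k : ℝ) + 1) ∧ F z < 1 / ((k : ℝ) + 1)} :=
      by
      rw [Set.ofPred_and]
      exact (isOpen_lt (continuous_id.dist continuous_const) continuous_const).inter
        (isOpen_lt hF continuous_const)
    have hy' := Metric.mem_closedBall.1 hy
    exact (TopologicalSpace.denseRange_denseSeq E).exists_mem_open hU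
      ⟨y, by linarith, by linarith⟩
  · intro h
    choose n h1 h2 using h
    have h0 : Tendsto (fun k : ℕ => 1 / ((k : ℝ) + 1)) atTop (𝓝 0) :=
      tendsto_one_div_add_atTop_nhds_zero_nat
    have hle : ∀ k : ℕ, 1 / ((k : ℝ) + 1) ≤ 1 := fun k => by
      rw [div_le_one (by positivity)]; linarith [(Nat.cast_nonneg k : (0 : ℝ) ≤ k)]
    -- Slack at most 1 confines all approximate solutions to one compact ball.
    obtain ⟨y, -, φ, hφ, hy⟩ := (isCompact_closedBall q (s + 1)).tendsto_subseq
      (x := fun k => TopologicalSpace.denseSeq E (n k))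
      (fun k => Metric.mem_closedBall.2 (by linarith [h1 k, hle k]))
    refine ⟨y, Metric.mem_closedBall.2 ?_, ?_⟩
    · have h3 := (h0.comp hφ.tendsto_atTop).const_add s
      rw [add_zero] at h3
      exact le_of_tendsto_of_tendsto (hy.dist tendsto_const_nhds) h3
        (Eventually.of_forall fun k => (h1 (φ k)).le)
    · exact le_of_tendsto_of_tendsto ((hF.tendsto y).comp hy) (h0.comp hφ.tendsto_atTop)
        (Eventually.of_forall fun k => (h2 (φ k)).le)

theorem nullMeasurableSet_exists_mem_closedBall_nonpos [MetricSpace E] [ProperSpace E] [Nonempty E]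
    {G : E → α → ℝ} (hc : ∀ᵐ t ∂μ, Continuous fun y => G y t) (hm : ∀ y, AEMeasurable (G y) μ)
    (q : E) (s : ℝ) :
    NullMeasurableSet {t | ∃ y ∈ Metric.closedBall q s, G y t ≤ 0} μ := by
  have h : NullMeasurableSet {t | ∀ k : ℕ, ∃ n : ℕ,
      dist (TopologicalSpace.denseSeq E n) q < s + 1 / ((k : ℝ) + 1) ∧
        G (TopologicalSpace.denseSeq E n) t < 1 / ((k : ℝ) + 1)} μ := by
    simp only [Set.ofPred_forall, Set.ofPred_exists, Set.ofPred_and]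
    exact .iInter fun k => .iUnion fun n => (MeasurableSet.const _).nullMeasurableSet.inter
      (nullMeasurableSet_lt (hm _) aemeasurable_const)
  refine h.congr ?_
  filter_upwards [hc] with t ht
  exact propext (exists_mem_closedBall_nonpos_iff ht q s).symm

theorem nullMeasurableSet_exists_nonpos [MetricSpace E] [ProperSpace E] [Nonempty E]
    {G : E → α → ℝ} (hc : ∀ᵐ t ∂μ, Continuous fun y => G y t) (hm : ∀ y, AEMeasurable (G y) μ) :
    NullMeasurableSet {t | ∃ y, G y t ≤ 0} μ := by
  obtain ⟨q⟩ := ‹Nonempty E›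
  have : {t | ∃ y, G y t ≤ 0} = ⋃ k : ℕ, {t | ∃ y ∈ Metric.closedBall q k, G y t ≤ 0} := by
    ext t
    simp only [Set.mem_ofPred_eq, Set.mem_iUnion]
    constructor
    · rintro ⟨y, hy⟩
      obtain ⟨k, hk⟩ := exists_nat_ge (dist y q)
      exact ⟨k, y, hk, hy⟩
    · rintro ⟨k, y, -, hy⟩
      exact ⟨y, hy⟩
  rw [this]
  exact .iUnion fun k => nullMeasurableSet_exists_mem_closedBall_nonpos hc hm q k

/-- Taking the least admissible index at every stage keeps the choice measurable, since indices
range over `ℕ`. This is the combinatorial core of the selection theorem. -/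
theorem exists_measurable_index_seq {H : ℕ → ℕ → Set α} (hH : ∀ j m, MeasurableSet (H j m))
    {r : ℕ → ℕ → ℕ → Prop} (h0 : ∀ t, ∃ m, t ∈ H 0 m)
    (hs : ∀ t j m, t ∈ H j m → ∃ m', t ∈ H (j + 1) m' ∧ r j m m') :
    ∃ i : ℕ → α → ℕ, (∀ j, Measurable (i j)) ∧ (∀ j t, t ∈ H j (i j t)) ∧
      ∀ j t, r j (i j t) (i (j + 1) t) := by
  classical
  have step : ∀ (j : ℕ) (f : α → ℕ), (Measurable f ∧ ∀ t, t ∈ H j (f t)) →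
      ∃ f' : α → ℕ, (Measurable f' ∧ ∀ t, t ∈ H (j + 1) (f' t)) ∧ ∀ t, r j (f t) (f' t) := by
    rintro j f ⟨hf, hft⟩
    have hex := fun t => hs t j (f t) (hft t)
    refine ⟨fun t => Nat.find (hex t), ⟨measurable_find hex fun m' => ?_,
      fun t => (Nat.find_spec (hex t)).1⟩, fun t => (Nat.find_spec (hex t)).2⟩
    exact (hH _ _).inter (hf (MeasurableSet.of_discrete (s := {m | r j m m'})))
  choose! next hnext hr using step
  let i : ℕ → α → ℕ := fun j => Nat.rec (fun t => Nat.find (h0 t)) next j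
  have hi : ∀ j, Measurable (i j) ∧ ∀ t, t ∈ H j (i j t) := by
    intro j
    induction j with
    | zero => exact ⟨measurable_find h0 fun m => hH _ _, fun t => Nat.find_spec (h0 t)⟩
    | succ j ih => exact hnext j _ ih
  exact ⟨i, fun j => (hi j).1, fun j => (hi j).2, fun j => hr j _ (hi j)⟩

/-- Measurable selection from the sublevel sets of a Carathéodory function. -/
theorem exists_measurable_selection_nonpos [MetricSpace E] [ProperSpace E] [Nonempty E]
    [MeasurableSpace E] [BorelSpace E]
    {G : E → α → ℝ} (hc : ∀ᵐ t ∂μ, Continuous fun y => G y t) (hm : ∀ y, AEMeasurable (G y) μ)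
    (hne : ∀ᵐ t ∂μ, ∃ y, G y t ≤ 0) :
    ∃ x : α → E, Measurable x ∧ ∀ᵐ t ∂μ, G (x t) t ≤ 0 := by
  let d := TopologicalSpace.denseSeq E
  have hd : DenseRange d := TopologicalSpace.denseRange_denseSeq E
  let S : ℕ → ℕ → Set α := fun j m => {t | ∃ y ∈ Metric.closedBall (d m) ((1 / 2) ^ j), G y t ≤ 0}
  have hS : ∀ j m, ∃ A, MeasurableSet A ∧ A =ᵐ[μ] S j m := fun j m => by
    obtain ⟨A, -, hA, hAS⟩ := (nullMeasurableSet_exists_mem_closedBall_nonpos hc hm (d m)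
      ((1 / 2) ^ j)).exists_measurable_superset_ae_eq
    exact ⟨A, hA, hAS⟩
  choose A hA hAS using hS
  have hgood : ∀ᵐ t ∂μ, (∀ j m, t ∈ A j m ↔ t ∈ S j m) ∧ (∃ y, G y t ≤ 0) ∧
      Continuous fun y => G y t := by
    filter_upwards [ae_all_iff.2 fun j => ae_all_iff.2 fun m => (hAS j m).mem_iff, hne, hc]
      with t h1 h2 h3
    exact ⟨h1, h2, h3⟩
  obtain ⟨Ω, hΩ, hΩm, hΩg⟩ := hgood.exists_measurable_mem
  -- Adjoining `Ωᶜ` makes an index available at every `t`, including the exceptional null set. In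
  -- the step bound, a common solution `y` lies within `(1/2)^j` of the old center and `(1/2)^(j+1)`
  -- of the new one.
  obtain ⟨i, him, hiH, hir⟩ := exists_measurable_index_seq (H := fun j m => A j m ∪ Ωᶜ)
    (r := fun j m m' => dist (d m) (d m') ≤ 2 * (1 / 2) ^ j)
    (fun j m => (hA j m).union hΩm.compl) (fun t => by
      by_cases ht : t ∈ Ω
      · obtain ⟨hAS, ⟨y, hy⟩, -⟩ := hΩg t ht
        obtain ⟨m, hm'⟩ := hd.exists_dist_lt y one_pos
        exact ⟨m, .inl ((hAS 0 m).2 ⟨y, by simpa using hm'.le, hy⟩)⟩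
      · exact ⟨0, .inr ht⟩) (fun t j m htm => by
      by_cases ht : t ∈ Ω
      · obtain ⟨hAS, -, -⟩ := hΩg t ht
        obtain ⟨y, hym, hy⟩ := (hAS j m).1 (htm.resolve_right fun h => h ht)
        have hpos : (0 : ℝ) < (1 / 2) ^ (j + 1) := by positivity
        obtain ⟨m', hm'⟩ := hd.exists_dist_lt y hpos
        refine ⟨m', .inl ((hAS _ m').2 ⟨y, hm'.le, hy⟩), ?_⟩
        have h1 := dist_triangle (d m) y (d m')
        have h2 : dist (d m) y ≤ (1 / 2) ^ j := by
          rw [dist_comm]; exact hym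
        have h3 : ((1 : ℝ) / 2) ^ (j + 1) ≤ (1 / 2) ^ j :=
          pow_le_pow_of_le_one (by norm_num) (by norm_num) (Nat.le_succ j)
        linarith
      · exact ⟨m, .inr ht, by rw [dist_self]; positivity⟩)
  have hcau : ∀ t, CauchySeq fun j => d (i j t) := fun t =>
    cauchySeq_of_le_geometric (1 / 2) 2 (by norm_num) fun j => hir j t
  choose x hx using fun t => cauchySeq_tendsto_of_complete (hcau t)
  refine ⟨x, measurable_of_tendsto_metrizable
    (fun j => (Measurable.of_discrete (f := d)).comp (him j)) (tendsto_pi_nhds.2 hx), ?_⟩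
  filter_upwards [hΩ] with t ht
  obtain ⟨hAS, -, hct⟩ := hΩg t ht
  -- Each chosen ball contains a true solution; as the radii shrink, these solutions converge to `x
  -- t`, and continuity passes the inequality to the limit.
  have hy : ∀ j, ∃ y ∈ Metric.closedBall (d (i j t)) ((1 / 2) ^ j), G y t ≤ 0 := fun j =>
    (hAS j _).1 ((hiH j t).resolve_right fun h => h ht)
  choose y hyd hy0 using hy
  have hyx : Tendsto y atTop (𝓝 (x t)) := by
    refine (hx t).congr_dist (squeeze_zero (fun _ => dist_nonneg) (fun j => ?_)
      (tendsto_pow_atTop_nhds_zero_of_lt_one (r := (1 / 2 : ℝ)) (by norm_num) (by norm_num)))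
    rw [dist_comm]
    exact hyd j
  exact le_of_tendsto ((hct.tendsto _).comp hyx) (Eventually.of_forall hy0)

end Selection

/-- Continuity from above on a finite measure space; this supplies the truncation level for the
multipliers. -/
theorem exists_measure_norm_gt_lt {α F : Type*} [MeasurableSpace α] {μ : Measure α}
    [IsFiniteMeasure μ] [NormedAddCommGroup F] [MeasurableSpace F] [OpensMeasurableSpace F]
    {w : α → F} (hw : Measurable w) {η : ENNReal} (hη : 0 < η) :
    ∃ M : ℝ, μ {t | M < ‖w t‖} < η := by
  have hlim := tendsto_measure_iInter_atTop (μ := μ) (s := fun k : ℕ => {t | (k : ℝ) < ‖w t‖})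
    (fun k => (measurableSet_lt measurable_const hw.norm).nullMeasurableSet)
    (fun a b hab t (ht : (b : ℝ) < ‖w t‖) =>
      show (a : ℝ) < ‖w t‖ from (Nat.cast_le.2 hab).trans_lt ht) ⟨0, measure_ne_top _ _⟩
  have hemp : ⋂ k : ℕ, {t | (k : ℝ) < ‖w t‖} = ∅ := by
    ext t
    simp only [Set.mem_iInter, Set.mem_ofPred_eq, Set.mem_empty_iff_false, iff_false, not_forall,
      not_lt]
    exact exists_nat_ge _
  rw [hemp, measure_empty] at hlim
  obtain ⟨k, hk⟩ := (hlim.eventually_lt_const hη).exists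
  exact ⟨k, hk⟩

/-! ### Measurability and continuity of gradients -/

section Gradient

variable {α : Type*} [MeasurableSpace α] {μ : Measure α} {n : ℕ}

/-- Each coordinate is a limit of difference quotients with step `1/k`, which are a.e.-measurable in
`t`. -/
theorem aemeasurable_gradient {f : EuclideanSpace ℝ (Fin n) → α → ℝ}
    (hd : ∀ᵐ t ∂μ, Differentiable ℝ fun x => f x t) (hm : ∀ x, AEMeasurable (f x) μ)
    (x : EuclideanSpace ℝ (Fin n)) :
    AEMeasurable (fun t => gradient (fun y => f y t) x) μ := by
  have hcoord : ∀ e : EuclideanSpace ℝ (Fin n),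
      AEMeasurable (fun t => inner ℝ e (gradient (fun y => f y t) x)) μ := by
    intro e
    refine aemeasurable_of_tendsto_metrizable_ae atTop
      (f := fun (k : ℕ) t => (k : ℝ) • (f (x + (k : ℝ)⁻¹ • e) t - f x t))
      (fun k => ((hm (x + (k : ℝ)⁻¹ • e)).sub (hm x)).const_smul (k : ℝ)) ?_
    filter_upwards [hd] with t ht
    have := (ht x).hasFDerivAt.lim e (c := fun k : ℕ => (k : ℝ)) (l := atTop)
      (by simpa using tendsto_natCast_atTop_atTop (R := ℝ))
    simpa [inner_gradient_right] using this
  let b := EuclideanSpace.basisFun (Fin n) ℝ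
  have : (fun t => gradient (fun y => f y t) x) =
      fun t => ∑ i, (inner ℝ (b i) (gradient (fun y => f y t) x) : ℝ) • b i := by
    ext1 t
    exact (b.sum_repr' _).symm
  rw [this]
  exact Finset.aemeasurable_fun_sum _ fun i _ => (hcoord _).smul_const _

theorem continuous_gradient {E : Type*} [NormedAddCommGroup E] [InnerProductSpace ℝ E]
    [CompleteSpace E] {f : E → ℝ} (hf : ContDiff ℝ 1 f) : Continuous (gradient f) :=
  (InnerProductSpace.toDual ℝ E).symm.continuous.comp (hf.continuous_fderiv one_ne_zero)

end Gradient

/-! ### Quadratic penalty and approximate KKT in finite dimension -/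

section Penalty

/-- Squaring flattens the kink of the positive part, so the inequality penalty stays differentiable.
-/
theorem hasDerivAt_max_zero_sq (s : ℝ) :
    HasDerivAt (fun s : ℝ => max s 0 ^ 2) (2 * max s 0) s := by
  rcases lt_trichotomy s 0 with hs | rfl | hs
  · rw [max_eq_right hs.le, mul_zero]
    refine (hasDerivAt_const s (0 : ℝ)).congr_of_eventuallyEq ?_
    filter_upwards [eventually_lt_nhds hs] with z hz
    simp [max_eq_right hz.le]
  · rw [max_self, mul_zero, hasDerivAt_iff_isLittleO_nhds_zero]
    have h : (fun z : ℝ => z ^ 2) =o[𝓝 0] fun z : ℝ => z := by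
      simpa using Asymptotics.isLittleO_pow_pow (𝕜 := ℝ) (m := 1) (n := 2) (by norm_num)
    refine Asymptotics.IsBigO.trans_isLittleO (.of_norm_le fun z => ?_) h
    rcases le_total z 0 with hz | hz <;> simp [hz, sq_nonneg]
  · rw [max_eq_left hs.le]
    have h := hasDerivAt_pow 2 s
    simp only [Nat.cast_ofNat, Nat.add_one_sub_one, pow_one] at h
    refine h.congr_of_eventuallyEq ?_
    filter_upwards [eventually_gt_nhds hs] with z hz
    simp [max_eq_left hz.le]

variable {E : Type*} [NormedAddCommGroup E] [ProperSpace E]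

/-- Exterior penalization: near a constrained local minimizer there are local minimizers of the
proximally regularized penalized function. -/
theorem exists_isLocalMin_penalty {f P : E → ℝ} (hf : Continuous f) (hP : Continuous P)
    (hP0 : ∀ y, 0 ≤ P y) {x : E} {R : ℝ} (hR : 0 < R) (hx : P x = 0)
    (hmin : ∀ y ∈ Metric.closedBall x R, P y = 0 → f x ≤ f y) {ε : ℝ} (hε : 0 < ε) :
    ∃ (k : ℕ) (y : E), ‖y - x‖ < ε ∧
      IsLocalMin (fun z => f z + k * P z + ‖z - x‖ ^ 2 / 2) y := by
  have hK : IsCompact (Metric.closedBall x R) := isCompact_closedBall x R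
  have hxK : x ∈ Metric.closedBall x R := Metric.mem_closedBall_self hR.le
  have hex : ∀ k : ℕ, ∃ y ∈ Metric.closedBall x R, IsMinOn
      (fun z => f z + k * P z + ‖z - x‖ ^ 2 / 2) (Metric.closedBall x R) y := fun k =>
    hK.exists_isMinOn ⟨x, hxK⟩ (by fun_prop)
  choose y hyK hymin using hex
  have hle : ∀ k : ℕ, f (y k) + k * P (y k) + ‖y k - x‖ ^ 2 / 2 ≤ f x := fun k => by
    simpa [hx] using hymin k hxK
  -- If all penalized minimizers stayed away from `x`, a cluster point `z` would satisfy `P z = 0`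
  -- and `f z + ‖z - x‖ ^ 2 / 2 ≤ f x ≤ f z`, forcing `z = x`. The minimum `f w` over the ball
  -- bounds `P (y k)` by `(f x - f w) / k`.
  obtain ⟨k, hk⟩ : ∃ k, ‖y k - x‖ < min ε R := by
    by_contra! hcon
    obtain ⟨z, hzK, ψ, hψ, hz⟩ := hK.tendsto_subseq hyK
    obtain ⟨w, hwK, hw⟩ := hK.exists_isMinOn ⟨x, hxK⟩ hf.continuousOn
    have hψ' : Tendsto (fun k => ((ψ k : ℕ) : ℝ)) atTop atTop :=
      tendsto_natCast_atTop_atTop.comp hψ.tendsto_atTop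
    have hPz : P z = 0 := by
      refine le_antisymm ?_ (hP0 z)
      refine le_of_tendsto_of_tendsto ((hP.tendsto z).comp hz)
        (hψ'.const_div_atTop (f x - f w)) ?_
      filter_upwards [hψ'.eventually_gt_atTop 0] with j hj
      rw [Function.comp_apply, Function.comp_apply, le_div_iff₀ hj]
      have h1 := hle (ψ j)
      have h2 : f w ≤ f (y (ψ j)) := hw (hyK (ψ j))
      nlinarith [sq_nonneg ‖y (ψ j) - x‖]
    have hlim : f z + ‖z - x‖ ^ 2 / 2 ≤ f x := by
      have hc : Continuous fun z => f z + ‖z - x‖ ^ 2 / 2 := by fun_prop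
      refine le_of_tendsto ((hc.tendsto z).comp hz) (Eventually.of_forall fun j => ?_)
      have h1 := hle (ψ j)
      have h2 : (0 : ℝ) ≤ (ψ j : ℝ) * P (y (ψ j)) := mul_nonneg (Nat.cast_nonneg _) (hP0 _)
      simp only [Function.comp_apply]
      linarith
    have hfar : min ε R ≤ ‖z - x‖ := by
      have hc : Continuous fun z => ‖z - x‖ := by fun_prop
      exact ge_of_tendsto ((hc.tendsto z).comp hz) (Eventually.of_forall fun j => hcon _)
    have h3 := hmin z hzK hPz
    have h4 : 0 < min ε R := lt_min hε hR
    have h5 : 0 < ‖z - x‖ ^ 2 := by have := h4.trans_le hfar; positivity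
    linarith
  refine ⟨k, y k, hk.trans_le (min_le_left _ _), (hymin k).isLocalMin ?_⟩
  exact mem_of_superset (Metric.isOpen_ball.mem_nhds
    (mem_ball_iff_norm.2 (hk.trans_le (min_le_right _ _)))) Metric.ball_subset_closedBall

/-- A constrained local minimizer satisfies the approximate KKT conditions. -/
theorem exists_approximate_kkt [InnerProductSpace ℝ E] {ι κ : Type*} [Fintype ι] [Fintype κ] {f : E → ℝ} {h : ι → E → ℝ}
    {g : κ → E → ℝ} (hf : Differentiable ℝ f) (hh : ∀ i, Differentiable ℝ (h i))
    (hg : ∀ j, Differentiable ℝ (g j)) {x : E} {R : ℝ} (hR : 0 < R) (hhx : ∀ i, h i x = 0)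
    (hgx : ∀ j, g j x ≤ 0)
    (hmin : ∀ y ∈ Metric.closedBall x R, (∀ i, h i y = 0) → (∀ j, g j y ≤ 0) → f x ≤ f y)
    {ε : ℝ} (hε : 0 < ε) :
    ∃ (y : E) (u : ι → ℝ) (v : κ → ℝ), ‖y - x‖ ≤ ε ∧ (∀ j, 0 ≤ v j) ∧
      (∀ j, v j * max (-(g j y)) 0 = 0) ∧
      ‖fderiv ℝ f y + ∑ i, u i • fderiv ℝ (h i) y + ∑ j, v j • fderiv ℝ (g j) y‖ ≤ ε := by
  let P : E → ℝ := fun y => (∑ i, h i y ^ 2 + ∑ j, max (g j y) 0 ^ 2) / 2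
  have hPc : Continuous P := by
    have h1 := fun i => (hh i).continuous
    have h2 := fun j => (hg j).continuous
    fun_prop
  have hPs : ∀ y, 0 ≤ ∑ i, h i y ^ 2 ∧ 0 ≤ ∑ j, max (g j y) 0 ^ 2 := fun y =>
    ⟨Finset.sum_nonneg fun _ _ => sq_nonneg _, Finset.sum_nonneg fun _ _ => sq_nonneg _⟩
  have hP0 : ∀ y, 0 ≤ P y := fun y => by
    have := hPs y
    show 0 ≤ (_ + _) / 2
    linarith
  have hPx : P x = 0 := by simp [P, hhx, hgx]
  obtain ⟨k, y, hy, hloc⟩ := exists_isLocalMin_penalty hf.continuous hPc hP0 hR hPx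
    (fun y hyR hPy => by
      have hP' : (∑ i, h i y ^ 2 + ∑ j, max (g j y) 0 ^ 2) / 2 = 0 := hPy
      have h1 : ∑ i, h i y ^ 2 = 0 := by linarith [(hPs y).1, (hPs y).2]
      have h2 : ∑ j, max (g j y) 0 ^ 2 = 0 := by linarith [(hPs y).1, (hPs y).2]
      rw [Finset.sum_eq_zero_iff_of_nonneg fun _ _ => sq_nonneg _] at h1 h2
      refine hmin y hyR (fun i => by simpa using h1 i) fun j => ?_
      simpa using h2 j) hε
  -- The multipliers are the coefficients in the derivative of `k * P`; the factor 1/2 in `P`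
  -- cancels the 2 from the squares. Complementarity is exact because the positive and negative
  -- parts of `g j y` have product zero.
  refine ⟨y, fun i => k * h i y, fun j => k * max (g j y) 0, hy.le,
    fun j => mul_nonneg (Nat.cast_nonneg _) (le_max_right _ _), fun j => ?_, ?_⟩
  · rcases le_total (g j y) 0 with hj | hj <;> simp [hj]
  have hPd : HasFDerivAt P (∑ i, h i y • fderiv ℝ (h i) y +
      ∑ j, max (g j y) 0 • fderiv ℝ (g j) y) y := by
    have h1 : ∀ i, HasFDerivAt (fun y => h i y ^ 2) ((2 * h i y) • fderiv ℝ (h i) y) y :=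
      fun i => by simpa using (hh i y).hasFDerivAt.pow 2
    have h2 : ∀ j, HasFDerivAt (fun y => max (g j y) 0 ^ 2)
        ((2 * max (g j y) 0) • fderiv ℝ (g j) y) y :=
      fun j => (hasDerivAt_max_zero_sq (g j y)).comp_hasFDerivAt y (hg j y).hasFDerivAt
    have h3 := ((HasFDerivAt.fun_sum fun i (_ : i ∈ Finset.univ) => h1 i).add
      (HasFDerivAt.fun_sum fun j (_ : j ∈ Finset.univ) => h2 j)).const_mul (1 / 2 : ℝ)
    refine (h3.congr_fderiv ?_).congr_of_eventuallyEq (.of_forall fun z => ?_)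
    rotate_left
    · simp only [P, Pi.add_apply]; ring
    · simp only [smul_add, Finset.smul_sum, smul_smul]
      congr 1 <;> refine Finset.sum_congr rfl fun i _ => ?_ <;> congr 1 <;> ring
  have hNd : HasFDerivAt (fun z => ‖z - x‖ ^ 2 / 2) (innerSL ℝ (y - x)) y := by
    have h1 := (((hasFDerivAt_id y).sub_const x).norm_sq).const_mul (1 / 2 : ℝ)
    refine (h1.congr_fderiv ?_).congr_of_eventuallyEq (.of_forall fun z => ?_)
    · ext z; simp
    · simp only [id_eq]; ring
  -- Stationarity leaves the derivative of the Lagrangian equal to minus that of the proximal term,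
  -- whose norm is `‖y - x‖`.
  have h0 := hloc.hasFDerivAt_eq_zero ((hf y).hasFDerivAt.add (hPd.const_mul (k : ℝ)) |>.add hNd)
  have h1 : fderiv ℝ f y + ∑ i, (k * h i y) • fderiv ℝ (h i) y +
      ∑ j, (k * max (g j y) 0) • fderiv ℝ (g j) y = - innerSL ℝ (y - x) := by
    rw [← add_eq_zero_iff_eq_neg, ← h0]
    simp only [smul_add, Finset.smul_sum, smul_smul, add_assoc]
  rw [h1, norm_neg, innerSL_apply_norm]
  exact hy.le

end Penalty

/-! ### Regularity and integrability of the problem data -/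

namespace CTProblem

variable {n p m : ℕ} {C : CTProblem n p m} {xbar : ℝ → EuclideanSpace ℝ (Fin n)} {r : ℝ}

instance : IsFiniteMeasure C.μ := by
  unfold CTProblem.μ
  infer_instance

theorem H2.contDiff_h (hH : C.H2 xbar r) :
    ∀ᵐ t ∂C.μ, ∀ i, ContDiff ℝ 1 fun x => C.h x t i := by
  filter_upwards [hH.contDiff] with t ht i
  exact (((EuclideanSpace.proj i : _ →L[ℝ] ℝ).comp (WithLp.fstL 2 ℝ _ _)).contDiff).comp ht

theorem H2.contDiff_g (hH : C.H2 xbar r) :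
    ∀ᵐ t ∂C.μ, ∀ j, ContDiff ℝ 1 fun x => C.g x t j := by
  filter_upwards [hH.contDiff] with t ht j
  exact (((EuclideanSpace.proj j : _ →L[ℝ] ℝ).comp (WithLp.sndL 2 ℝ _ _)).contDiff).comp ht

theorem H2.measurable_h (hH : C.H2 xbar r) (x : EuclideanSpace ℝ (Fin n)) (i : Fin p) :
    AEMeasurable (fun t => C.h x t i) C.μ :=
  (((EuclideanSpace.proj i : _ →L[ℝ] ℝ).comp (WithLp.fstL 2 ℝ
    (EuclideanSpace ℝ (Fin p)) (EuclideanSpace ℝ (Fin m)))).measurable).comp_aemeasurable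
    (hH.measurable x)

theorem H2.measurable_g (hH : C.H2 xbar r) (x : EuclideanSpace ℝ (Fin n)) (j : Fin m) :
    AEMeasurable (fun t => C.g x t j) C.μ :=
  (((EuclideanSpace.proj j : _ →L[ℝ] ℝ).comp (WithLp.sndL 2 ℝ
    (EuclideanSpace ℝ (Fin p)) (EuclideanSpace ℝ (Fin m)))).measurable).comp_aemeasurable
    (hH.measurable x)

/-- The Lipschitz bound dominates the deviation from the cost integrand at `xbar`. Glued competitors
thus become eligible for local optimality, which compares only integrable costs. -/
theorem H1.integrable_cost (hH : C.H1 xbar r) {R : ℝ} (hR : R ≤ r)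
    (hxbar : AEMeasurable xbar C.μ) {x : ℝ → EuclideanSpace ℝ (Fin n)} (hx : AEMeasurable x C.μ)
    (hxR : ∀ᵐ t ∂C.μ, x t ∈ Metric.closedBall (xbar t) R) :
    Integrable (fun t => C.φ (x t) t) C.μ := by
  have hc : ∀ᵐ t ∂C.μ, Continuous fun y => C.φ y t := hH.contDiff.mono fun t ht => ht.continuous
  have hxb := aemeasurable_comp_of_continuous_left hc hH.measurable hxbar
  have hxm := aemeasurable_comp_of_continuous_left hc hH.measurable hx
  have hint : Integrable (fun t => C.φ (xbar t) t) C.μ :=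
    (integrable_norm_iff hxb.aestronglyMeasurable).1 hH.integrable
  obtain ⟨c, hci, hcl⟩ := hH.lipschitz
  have hdiff : Integrable (fun t => C.φ (x t) t - C.φ (xbar t) t) C.μ := by
    refine (hci.norm.mul_const R).mono' (hxm.sub hxb).aestronglyMeasurable ?_
    filter_upwards [hcl, hxR] with t ht hxt
    have h0 : ‖x t - xbar t‖ ≤ R := mem_closedBall_iff_norm.1 hxt
    have hR0 : 0 ≤ R := (norm_nonneg _).trans h0
    calc ‖C.φ (x t) t - C.φ (xbar t) t‖ ≤ c t * ‖x t - xbar t‖ :=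
          ht _ (Metric.closedBall_subset_closedBall hR hxt) _
            (Metric.mem_closedBall_self (hR0.trans hR))
      _ ≤ ‖c t‖ * R := mul_le_mul (le_abs_self _) h0 (norm_nonneg _) (norm_nonneg _)
  exact (hdiff.add hint).congr (.of_forall fun t => sub_add_cancel _ _)

/-! ### From local optimality to pointwise minimality -/

/-- The excess by which `y` fails, at time `t`, to be a point of the closed ball of radius `R`
around `xbar t` that satisfies the constraints and improves the integrand by `δ`. -/
noncomputable def excess (C : CTProblem n p m) (xbar : ℝ → EuclideanSpace ℝ (Fin n)) (R δ : ℝ)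
    (y : EuclideanSpace ℝ (Fin n)) (t : ℝ) : ℝ :=
  max (max (‖y - xbar t‖ - R) (∑ i, |C.h y t i| + ∑ j, max (C.g y t j) 0))
    (C.φ y t - C.φ (xbar t) t + δ)

theorem excess_nonpos_iff {R δ : ℝ} {y : EuclideanSpace ℝ (Fin n)} {t : ℝ} :
    C.excess xbar R δ y t ≤ 0 ↔ y ∈ Metric.closedBall (xbar t) R ∧
      ((∀ i, C.h y t i = 0) ∧ ∀ j, C.g y t j ≤ 0) ∧ C.φ y t ≤ C.φ (xbar t) t - δ := by
  have e1 : 0 ≤ ∑ i, |C.h y t i| := Finset.sum_nonneg fun _ _ => abs_nonneg _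
  have e2 : 0 ≤ ∑ j, max (C.g y t j) 0 := Finset.sum_nonneg fun _ _ => le_max_right _ _
  have e3 : ∑ i, |C.h y t i| + ∑ j, max (C.g y t j) 0 ≤ 0 ↔
      (∀ i, C.h y t i = 0) ∧ ∀ j, C.g y t j ≤ 0 := by
    rw [(add_nonneg e1 e2).ge_iff_eq', add_eq_zero_iff_of_nonneg e1 e2,
      Finset.sum_eq_zero_iff_of_nonneg fun _ _ => abs_nonneg _,
      Finset.sum_eq_zero_iff_of_nonneg fun _ _ => le_max_right _ _]
    simp
  rw [excess, max_le_iff, max_le_iff, e3, mem_closedBall_iff_norm, and_assoc, sub_nonpos]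
  refine and_congr_right fun _ => and_congr_right fun _ => ?_
  constructor <;> intro h <;> linarith

theorem ae_continuous_excess (h1 : C.H1 xbar r) (h2 : C.H2 xbar r) (R δ : ℝ) :
    ∀ᵐ t ∂C.μ, Continuous fun y => C.excess xbar R δ y t := by
  filter_upwards [h1.contDiff, h2.contDiff_h, h2.contDiff_g] with t ha hb hc
  have ha' := ha.continuous
  have hb' := fun i => (hb i).continuous
  have hc' := fun j => (hc j).continuous
  exact ((by fun_prop : Continuous fun y => ‖y - xbar t‖ - R).max
    ((continuous_finsetSum _ fun i _ => (hb' i).abs).add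
      (continuous_finsetSum _ fun j _ => (hc' j).max continuous_const))).max
    ((ha'.sub continuous_const).add continuous_const)

theorem aemeasurable_excess (h1 : C.H1 xbar r) (h2 : C.H2 xbar r) (hxm : AEMeasurable xbar C.μ)
    (R δ : ℝ) (y : EuclideanSpace ℝ (Fin n)) : AEMeasurable (C.excess xbar R δ y) C.μ := by
  have hφb := aemeasurable_comp_of_continuous_left
    (h1.contDiff.mono fun t ht => ht.continuous) h1.measurable hxm
  refine AEMeasurable.max (AEMeasurable.max ?_ (AEMeasurable.add ?_ ?_)) ?_
  · exact (aemeasurable_const.sub hxm).norm.sub_const R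
  · exact Finset.aemeasurable_fun_sum _ fun i _ =>
      continuous_abs.measurable.comp_aemeasurable (h2.measurable_h y i)
  · exact Finset.aemeasurable_fun_sum _ fun j _ => (h2.measurable_g y j).max aemeasurable_const
  · exact ((h1.measurable y).sub hφb).add_const δ

/-- A feasible point that stays near a local optimal solution cannot improve the integrand on a
set of positive measure and leave it unchanged elsewhere. -/
theorem measure_eq_zero_of_improving (hx : xbar ∈ C.feasible) {r₀ R δ : ℝ}
    (hloc : ∀ x ∈ C.feasible, (∀ᵐ t ∂C.μ, x t ∈ Metric.ball (xbar t) r₀) →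
      Integrable (fun t => C.φ (x t) t) C.μ → C.cost xbar ≤ C.cost x)
    (h1 : C.H1 xbar r) (hR : 0 < R) (hRr : R ≤ r) (hRr₀ : R < r₀) (hδ : 0 < δ) {A : Set ℝ}
    (hAm : MeasurableSet A) {s : ℝ → EuclideanSpace ℝ (Fin n)} (hs : Measurable s)
    (hsA : ∀ᵐ t ∂C.μ, t ∈ A → C.excess xbar R δ (s t) t ≤ 0) : C.μ A = 0 := by
  classical
  obtain ⟨hxL, hxh, hxg⟩ := hx
  have hxm : AEMeasurable xbar C.μ := hxL.aestronglyMeasurable.aemeasurable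
  by_contra hA0
  simp only [excess_nonpos_iff] at hsA
  obtain ⟨x, hx1, hx2, hxa⟩ : ∃ x : ℝ → EuclideanSpace ℝ (Fin n),
      (∀ t ∈ A, x t = s t) ∧ (∀ t ∉ A, x t = xbar t) ∧ AEMeasurable x C.μ := by
    refine ⟨A.piecewise s xbar, fun t ht => Set.piecewise_eq_of_mem _ _ _ ht,
      fun t ht => Set.piecewise_eq_of_notMem _ _ _ ht,
      A.piecewise s (hxm.mk xbar), hs.piecewise hAm hxm.measurable_mk, ?_⟩
    filter_upwards [hxm.ae_eq_mk] with t ht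
    by_cases hA : t ∈ A <;> simp [hA, ht]
  have hxR : ∀ᵐ t ∂C.μ, x t ∈ Metric.closedBall (xbar t) R := by
    filter_upwards [hsA] with t ht
    by_cases hA : t ∈ A
    · rw [hx1 t hA]; exact (ht hA).1
    · rw [hx2 t hA]; exact Metric.mem_closedBall_self hR.le
  have hfeas : x ∈ C.feasible := by
    refine ⟨?_, ?_, ?_⟩
    · have hd : MemLp (fun t => x t - xbar t) ⊤ C.μ :=
        memLp_top_of_bound (hxa.sub hxm).aestronglyMeasurable R
          (hxR.mono fun t ht => mem_closedBall_iff_norm.1 ht)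
      exact (hd.add hxL).ae_eq (.of_forall fun t => sub_add_cancel _ _)
    · filter_upwards [hsA, hxh] with t ht htx
      by_cases hA : t ∈ A
      · rw [hx1 t hA]; ext i; exact (ht hA).2.1.1 i
      · rwa [hx2 t hA]
    · filter_upwards [hsA, hxg] with t ht htx
      by_cases hA : t ∈ A
      · rw [hx1 t hA]; exact (ht hA).2.1.2
      · rwa [hx2 t hA]
  have hxi := h1.integrable_cost hRr hxm hxa hxR
  have hbi := h1.integrable_cost hRr hxm hxm
    (.of_forall fun t => Metric.mem_closedBall_self hR.le)
  have hcost := hloc x hfeas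
    (hxR.mono fun t ht => Metric.closedBall_subset_ball hRr₀ ht) hxi
  have hind : Integrable (A.indicator fun _ => δ) C.μ :=
    (integrable_const δ).indicator hAm
  have hlt : C.cost x ≤ C.cost xbar - C.μ.real A * δ := by
    have e : C.cost xbar - C.μ.real A * δ =
        ∫ t, (C.φ (xbar t) t - A.indicator (fun _ => δ) t) ∂C.μ := by
      rw [integral_sub hbi hind, integral_indicator_const _ hAm, smul_eq_mul, cost]
    rw [e]
    refine integral_mono_ae hxi (hbi.sub hind) ?_
    filter_upwards [hsA] with t ht
    by_cases hA : t ∈ A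
    · simpa [hA, hx1 t hA] using (ht hA).2.2
    · simp [hA, hx2 t hA]
  have hpos : 0 < C.μ.real A := ENNReal.toReal_pos hA0 (measure_ne_top _ _)
  nlinarith

/-- A local optimal solution minimizes the integrand pointwise among nearby points satisfying the
constraints. -/
theorem IsLocalOptimal.ae_isMin (hopt : C.IsLocalOptimal xbar) (hr : 0 < r) (h1 : C.H1 xbar r)
    (h2 : C.H2 xbar r) :
    ∃ R : ℝ, 0 < R ∧ ∀ᵐ t ∂C.μ, ∀ y ∈ Metric.closedBall (xbar t) R, (∀ i, C.h y t i = 0) →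
      (∀ j, C.g y t j ≤ 0) → C.φ (xbar t) t ≤ C.φ y t := by
  obtain ⟨hx, r₀, hr₀, hloc⟩ := hopt
  have hxm : AEMeasurable xbar C.μ := hx.1.aestronglyMeasurable.aemeasurable
  -- `R ≤ r` keeps the Lipschitz bounds available; `R < r₀` is strict because local optimality is
  -- stated with open balls.
  obtain ⟨R, hR, hRr, hRr₀⟩ : ∃ R : ℝ, 0 < R ∧ R ≤ r ∧ R < r₀ :=
    ⟨min r r₀ / 2, by positivity, by linarith [min_le_left r r₀, lt_min hr hr₀],
      by linarith [min_le_right r r₀, lt_min hr hr₀]⟩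
  refine ⟨R, hR, ?_⟩
  have key : ∀ δ : ℝ, 0 < δ → ∀ᵐ t ∂C.μ, ¬ ∃ y, C.excess xbar R δ y t ≤ 0 := by
    intro δ hδ
    have hGc := ae_continuous_excess h1 h2 R δ
    have hGm := aemeasurable_excess h1 h2 hxm R δ
    obtain ⟨A, hAs, hAm, hAe⟩ :=
      (nullMeasurableSet_exists_nonpos hGc hGm).exists_measurable_subset_ae_eq
    have hle : C.μ.restrict A ≤ C.μ := Measure.restrict_le_self
    -- Restricting the measure to `A` makes the sublevel sets nonempty a.e., as selection requires.
    obtain ⟨s, hs, hsG⟩ := exists_measurable_selection_nonpos (μ := C.μ.restrict A)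
      (ae_mono hle hGc) (fun y => (hGm y).mono_measure hle)
      ((ae_restrict_iff' hAm).2 (.of_forall fun t ht => hAs ht))
    rw [ae_restrict_iff' hAm] at hsG
    have hA0 := measure_eq_zero_of_improving hx hloc h1 hR hRr hRr₀ hδ hAm hs hsG
    filter_upwards [measure_eq_zero_iff_ae_notMem.1 hA0, hAe.mem_iff] with t ht hiff
    exact fun h => ht (hiff.2 h)
  have hall := ae_all_iff.2 fun k : ℕ => key (1 / ((k : ℝ) + 1)) Nat.one_div_pos_of_nat
  filter_upwards [hall] with t ht y hy hyh hyg
  by_contra! hlt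
  obtain ⟨k, hk⟩ := exists_nat_one_div_lt (sub_pos.2 hlt)
  exact ht k ⟨y, excess_nonpos_iff.2 ⟨hy, ⟨hyh, hyg⟩, by linarith⟩⟩

/-! ### The gradient of the Lagrangian -/

section GradLagrangian

theorem hasFDerivAt_lagrangian {x : EuclideanSpace ℝ (Fin n)} {t : ℝ}
    (hφ : DifferentiableAt ℝ (fun y => C.φ y t) x)
    (hh : ∀ i, DifferentiableAt ℝ (fun y => C.h y t i) x)
    (hg : ∀ j, DifferentiableAt ℝ (fun y => C.g y t j) x)
    (u : EuclideanSpace ℝ (Fin p)) (v : EuclideanSpace ℝ (Fin m)) :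
    HasFDerivAt (fun y => C.lagrangian y u v t)
      (fderiv ℝ (fun y => C.φ y t) x + ∑ i, u i • fderiv ℝ (fun y => C.h y t i) x +
        ∑ j, v j • fderiv ℝ (fun y => C.g y t j) x) x :=
  (hφ.hasFDerivAt.add (HasFDerivAt.fun_sum fun i _ => (hh i).hasFDerivAt.const_mul (u i))).add
    (HasFDerivAt.fun_sum fun j _ => (hg j).hasFDerivAt.const_mul (v j))

theorem norm_gradLagrangian {x : EuclideanSpace ℝ (Fin n)} {t : ℝ}
    (hφ : DifferentiableAt ℝ (fun y => C.φ y t) x)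
    (hh : ∀ i, DifferentiableAt ℝ (fun y => C.h y t i) x)
    (hg : ∀ j, DifferentiableAt ℝ (fun y => C.g y t j) x)
    (u : EuclideanSpace ℝ (Fin p)) (v : EuclideanSpace ℝ (Fin m)) :
    ‖C.gradLagrangian x u v t‖ = ‖fderiv ℝ (fun y => C.φ y t) x +
      ∑ i, u i • fderiv ℝ (fun y => C.h y t i) x +
        ∑ j, v j • fderiv ℝ (fun y => C.g y t j) x‖ := by
  rw [← (hasFDerivAt_lagrangian hφ hh hg u v).fderiv, gradLagrangian, gradient,
    LinearIsometryEquiv.norm_map]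

theorem gradLagrangian_eq {x : EuclideanSpace ℝ (Fin n)} {t : ℝ}
    (hφ : DifferentiableAt ℝ (fun y => C.φ y t) x)
    (hh : ∀ i, DifferentiableAt ℝ (fun y => C.h y t i) x)
    (hg : ∀ j, DifferentiableAt ℝ (fun y => C.g y t j) x)
    (u : EuclideanSpace ℝ (Fin p)) (v : EuclideanSpace ℝ (Fin m)) :
    C.gradLagrangian x u v t = gradient (fun y => C.φ y t) x +
      ∑ i, u i • gradient (fun y => C.h y t i) x +
        ∑ j, v j • gradient (fun y => C.g y t j) x := by
  rw [gradLagrangian, gradient, (hasFDerivAt_lagrangian hφ hh hg u v).fderiv]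
  simp [gradient, map_sum]

theorem gradLagrangian_zero (x : EuclideanSpace ℝ (Fin n)) (t : ℝ) :
    C.gradLagrangian x 0 0 t = gradient (fun y => C.φ y t) x := by
  simp [gradLagrangian, lagrangian]

theorem ae_gradLagrangian_eq (h1 : C.H1 xbar r) (h2 : C.H2 xbar r) :
    ∀ᵐ t ∂C.μ, ∀ (x : EuclideanSpace ℝ (Fin n)) (u : EuclideanSpace ℝ (Fin p))
      (v : EuclideanSpace ℝ (Fin m)), C.gradLagrangian x u v t = gradient (fun y => C.φ y t) x +
      ∑ i, u i • gradient (fun y => C.h y t i) x +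
        ∑ j, v j • gradient (fun y => C.g y t j) x := by
  filter_upwards [h1.contDiff, h2.contDiff_h, h2.contDiff_g] with t ha hb hc x u v
  exact gradLagrangian_eq (ha.differentiable one_ne_zero x)
    (fun i => (hb i).differentiable one_ne_zero x)
    (fun j => (hc j).differentiable one_ne_zero x) u v

/-- Continuous differentiability makes approximate stationarity a Carathéodory condition in `(x, u,
v)`, fit for selection. -/
theorem ae_continuous_gradLagrangian (h1 : C.H1 xbar r) (h2 : C.H2 xbar r) :
    ∀ᵐ t ∂C.μ, Continuous fun z : EuclideanSpace ℝ (Fin n) × EuclideanSpace ℝ (Fin p) ×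
      EuclideanSpace ℝ (Fin m) => C.gradLagrangian z.1 z.2.1 z.2.2 t := by
  filter_upwards [h1.contDiff, h2.contDiff_h, h2.contDiff_g, ae_gradLagrangian_eq h1 h2]
    with t ha hb hc heq
  simp only [heq]
  have ha' := continuous_gradient ha
  have hb' := fun i => continuous_gradient (hb i)
  have hc' := fun j => continuous_gradient (hc j)
  fun_prop

theorem aemeasurable_gradLagrangian (h1 : C.H1 xbar r) (h2 : C.H2 xbar r)
    (x : EuclideanSpace ℝ (Fin n)) (u : EuclideanSpace ℝ (Fin p))
    (v : EuclideanSpace ℝ (Fin m)) : AEMeasurable (C.gradLagrangian x u v) C.μ := by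
  have hφ := aemeasurable_gradient
    (h1.contDiff.mono fun t ht => ht.differentiable one_ne_zero) h1.measurable x
  have hh := fun i => aemeasurable_gradient
    (h2.contDiff_h.mono fun t ht => (ht i).differentiable one_ne_zero)
    (fun x => h2.measurable_h x i) x
  have hg := fun j => aemeasurable_gradient
    (h2.contDiff_g.mono fun t ht => (ht j).differentiable one_ne_zero)
    (fun x => h2.measurable_g x j) x
  have hsum := (hφ.add (Finset.aemeasurable_fun_sum Finset.univ fun i _ =>
    (hh i).const_smul (u i))).add
    (Finset.aemeasurable_fun_sum Finset.univ fun j _ => (hg j).const_smul (v j))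
  refine hsum.congr ?_
  filter_upwards [ae_gradLagrangian_eq h1 h2] with t ht
  exact (ht x u v).symm

theorem aemeasurable_gradLagrangian_comp (h1 : C.H1 xbar r) (h2 : C.H2 xbar r)
    {x : ℝ → EuclideanSpace ℝ (Fin n)} {u : ℝ → EuclideanSpace ℝ (Fin p)}
    {v : ℝ → EuclideanSpace ℝ (Fin m)} (hx : AEMeasurable x C.μ) (hu : AEMeasurable u C.μ)
    (hv : AEMeasurable v C.μ) :
    AEMeasurable (fun t => C.gradLagrangian (x t) (u t) (v t) t) C.μ :=
  aemeasurable_comp_of_continuous_left (E := EuclideanSpace ℝ (Fin n) × EuclideanSpace ℝ (Fin p) ×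
      EuclideanSpace ℝ (Fin m)) (f := fun z t => C.gradLagrangian z.1 z.2.1 z.2.2 t)
    (x := fun t => (x t, u t, v t)) (ae_continuous_gradLagrangian h1 h2)
    (fun z => aemeasurable_gradLagrangian h1 h2 z.1 z.2.1 z.2.2) (hx.prodMk (hu.prodMk hv))

/-- A Lipschitz constant near `xbar t` bounds the derivative there. This controls the Lagrangian
gradient on the exceptional sets, where the multipliers vanish. -/
theorem H1.exists_bound_gradient (h1 : C.H1 xbar r) (hr : 0 < r) :
    ∃ c : ℝ → ℝ, Integrable c C.μ ∧ ∀ᵐ t ∂C.μ, 0 ≤ c t ∧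
      ‖gradient (fun y => C.φ y t) (xbar t)‖ ≤ c t := by
  obtain ⟨c, hc, hcl⟩ := h1.lipschitz
  refine ⟨fun t => ‖c t‖, hc.norm, ?_⟩
  filter_upwards [hcl] with t ht
  refine ⟨norm_nonneg _, ?_⟩
  rw [gradient, LinearIsometryEquiv.norm_map]
  refine norm_fderiv_le_of_lip' ℝ (norm_nonneg _) ?_
  filter_upwards [Metric.closedBall_mem_nhds (xbar t) hr] with y hy
  exact (ht y hy _ (Metric.mem_closedBall_self hr.le)).trans
    (mul_le_mul_of_nonneg_right (le_abs_self _) (norm_nonneg _))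

end GradLagrangian

/-! ### Measurable approximate multipliers and their truncation -/

section ApproximateMultipliers

/-- The predicate that `(y, u, v)` satisfies the KKT conditions at time `t` up to `ε`. -/
structure IsKKTUpTo (C : CTProblem n p m) (xbar : ℝ → EuclideanSpace ℝ (Fin n)) (ε : ℝ)
    (y : EuclideanSpace ℝ (Fin n)) (u : EuclideanSpace ℝ (Fin p)) (v : EuclideanSpace ℝ (Fin m))
    (t : ℝ) : Prop where
  norm_sub_le : ‖y - xbar t‖ ≤ ε
  norm_grad_le : ‖C.gradLagrangian y u v t‖ ≤ ε
  nonneg : ∀ j, 0 ≤ v j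
  compl_le : ∀ j, v j * max (-(C.g y t j)) 0 ≤ ε

theorem IsLocalOptimal.ae_exists_isKKTUpTo (hopt : C.IsLocalOptimal xbar) (hr : 0 < r)
    (h1 : C.H1 xbar r) (h2 : C.H2 xbar r) {ε : ℝ} (hε : 0 < ε) :
    ∀ᵐ t ∂C.μ, ∃ y u v, C.IsKKTUpTo xbar ε y u v t := by
  obtain ⟨R, hR, hmin⟩ := hopt.ae_isMin hr h1 h2
  filter_upwards [hmin, h1.contDiff, h2.contDiff_h, h2.contDiff_g, hopt.1.2.1, hopt.1.2.2]
    with t ht ha hb hc hh hg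
  have ha' := ha.differentiable one_ne_zero
  have hb' := fun i => (hb i).differentiable one_ne_zero
  have hc' := fun j => (hc j).differentiable one_ne_zero
  obtain ⟨y, u, v, hy, hv, hcompl, hgrad⟩ := exists_approximate_kkt ha' hb' hc' hR
    (fun i => by rw [hh]; rfl) hg ht hε
  refine ⟨y, WithLp.toLp 2 u, WithLp.toLp 2 v, hy, ?_, hv, fun j => (hcompl j).le.trans hε.le⟩
  rw [norm_gradLagrangian (ha' y) (fun i => hb' i y) (fun j => hc' j y)]
  exact hgrad

/-- The excess in the conditions `IsKKTUpTo`. -/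
noncomputable def kktExcess (C : CTProblem n p m) (xbar : ℝ → EuclideanSpace ℝ (Fin n)) (ε : ℝ)
    (z : EuclideanSpace ℝ (Fin n) × EuclideanSpace ℝ (Fin p) × EuclideanSpace ℝ (Fin m))
    (t : ℝ) : ℝ :=
  max (max (‖z.1 - xbar t‖ - ε) (‖C.gradLagrangian z.1 z.2.1 z.2.2 t‖ - ε))
    (∑ j, (max (-(z.2.2 j)) 0 + max (z.2.2 j * max (-(C.g z.1 t j)) 0 - ε) 0))

theorem kktExcess_nonpos_iff {ε : ℝ}
    {z : EuclideanSpace ℝ (Fin n) × EuclideanSpace ℝ (Fin p) × EuclideanSpace ℝ (Fin m)} {t : ℝ} :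
    C.kktExcess xbar ε z t ≤ 0 ↔ C.IsKKTUpTo xbar ε z.1 z.2.1 z.2.2 t := by
  have e1 : ∀ j, 0 ≤ max (-(z.2.2 j)) 0 + max (z.2.2 j * max (-(C.g z.1 t j)) 0 - ε) 0 :=
    fun j => add_nonneg (le_max_right _ _) (le_max_right _ _)
  have e2 : ∑ j, (max (-(z.2.2 j)) 0 + max (z.2.2 j * max (-(C.g z.1 t j)) 0 - ε) 0) ≤ 0 ↔
      ∀ j, 0 ≤ z.2.2 j ∧ z.2.2 j * max (-(C.g z.1 t j)) 0 ≤ ε := by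
    rw [(Finset.sum_nonneg fun j _ => e1 j).ge_iff_eq',
      Finset.sum_eq_zero_iff_of_nonneg fun j _ => e1 j]
    simp only [Finset.mem_univ, true_imp_iff]
    refine forall_congr' fun j => ?_
    rw [add_eq_zero_iff_of_nonneg (le_max_right _ _) (le_max_right _ _), max_eq_right_iff,
      max_eq_right_iff, neg_nonpos, sub_nonpos]
  rw [kktExcess, max_le_iff, max_le_iff, e2, sub_nonpos, sub_nonpos]
  exact ⟨fun ⟨⟨a, b⟩, c⟩ => ⟨a, b, fun j => (c j).1, fun j => (c j).2⟩,
    fun ⟨a, b, c, d⟩ => ⟨⟨a, b⟩, fun j => ⟨c j, d j⟩⟩⟩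

theorem ae_continuous_kktExcess (h1 : C.H1 xbar r) (h2 : C.H2 xbar r) (ε : ℝ) :
    ∀ᵐ t ∂C.μ, Continuous fun z => C.kktExcess xbar ε z t := by
  filter_upwards [ae_continuous_gradLagrangian h1 h2, h2.contDiff_g] with t ha hc
  have hc' := fun j => (hc j).continuous
  have hv : ∀ j, Continuous fun z : EuclideanSpace ℝ (Fin n) × EuclideanSpace ℝ (Fin p) ×
      EuclideanSpace ℝ (Fin m) => z.2.2 j := fun j => by fun_prop
  refine (((continuous_fst.sub continuous_const).norm.sub continuous_const).max
    (ha.norm.sub continuous_const)).max (continuous_finsetSum _ fun j _ => ?_)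
  exact ((hv j).neg.max continuous_const).add
    ((((hv j).mul (((hc' j).comp continuous_fst).neg.max continuous_const)).sub
      continuous_const).max continuous_const)

theorem aemeasurable_kktExcess (h1 : C.H1 xbar r) (h2 : C.H2 xbar r) (hxm : AEMeasurable xbar C.μ)
    (ε : ℝ) (z : EuclideanSpace ℝ (Fin n) × EuclideanSpace ℝ (Fin p) × EuclideanSpace ℝ (Fin m)) :
    AEMeasurable (C.kktExcess xbar ε z) C.μ := by
  refine AEMeasurable.max (AEMeasurable.max ?_ ?_) ?_
  · exact (aemeasurable_const.sub hxm).norm.sub_const ε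
  · exact (aemeasurable_gradLagrangian h1 h2 z.1 z.2.1 z.2.2).norm.sub_const ε
  · exact Finset.aemeasurable_fun_sum _ fun j _ => aemeasurable_const.add
      (((((h2.measurable_g z.1 j).neg.max aemeasurable_const).const_mul _).sub_const ε).max
        aemeasurable_const)

/-- Bounded measurable approximate multipliers, off an exceptional set of small measure. -/
theorem IsLocalOptimal.exists_bounded_isKKTUpTo (hopt : C.IsLocalOptimal xbar) (hr : 0 < r)
    (h1 : C.H1 xbar r) (h2 : C.H2 xbar r) {ε : ℝ} (hε : 0 < ε) {η : ENNReal} (hη : 0 < η) :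
    ∃ (x : ℝ → EuclideanSpace ℝ (Fin n)) (u : ℝ → EuclideanSpace ℝ (Fin p))
      (v : ℝ → EuclideanSpace ℝ (Fin m)) (B : Set ℝ),
      MemLp x ⊤ C.μ ∧ MemLp u ⊤ C.μ ∧ MemLp v ⊤ C.μ ∧ C.μ B < η ∧
      (∀ t ∈ B, x t = xbar t ∧ u t = 0 ∧ v t = 0) ∧
      ∀ᵐ t ∂C.μ, t ∉ B → C.IsKKTUpTo xbar ε (x t) (u t) (v t) t := by
  classical
  have hxL := hopt.1.1
  have hxm : AEMeasurable xbar C.μ := hxL.aestronglyMeasurable.aemeasurable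
  obtain ⟨z, hz, hzK⟩ := exists_measurable_selection_nonpos (ae_continuous_kktExcess h1 h2 ε)
    (aemeasurable_kktExcess h1 h2 hxm ε) (by
      filter_upwards [hopt.ae_exists_isKKTUpTo hr h1 h2 hε] with t ⟨y, u, v, h⟩
      exact ⟨(y, u, v), kktExcess_nonpos_iff.2 h⟩)
  simp only [kktExcess_nonpos_iff] at hzK
  obtain ⟨M, hM⟩ := exists_measure_norm_gt_lt (μ := C.μ) hz.snd hη
  let B : Set ℝ := {t | M < ‖(z t).2‖}
  have hB : MeasurableSet B := measurableSet_lt measurable_const hz.snd.norm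
  have hbound : ∀ t ∉ B, ‖(z t).2‖ ≤ M := fun t ht => not_lt.1 ht
  -- Off `B` this is the selected point. Written as a perturbation of `xbar` of norm at most `ε`
  -- a.e., it is visibly in `L^∞`.
  refine ⟨fun t => xbar t + Bᶜ.indicator (fun t => (z t).1 - xbar t) t,
    Bᶜ.indicator fun t => (z t).2.1, Bᶜ.indicator fun t => (z t).2.2, B, ?_, ?_, ?_, hM, ?_, ?_⟩
  · refine hxL.add (memLp_top_of_bound
      ((hz.fst.aemeasurable.sub hxm).indicator hB.compl).aestronglyMeasurable ε ?_)
    filter_upwards [hzK] with t ht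
    exact (norm_indicator_le_norm_self _ _).trans ht.norm_sub_le
  · refine memLp_top_of_bound (hz.snd.fst.indicator hB.compl).aestronglyMeasurable (max M 0)
      (.of_forall fun t => ?_)
    by_cases ht : t ∈ B
    · simp [ht]
    · simpa [ht] using .inl ((norm_fst_le (z t).2).trans (hbound t ht))
  · refine memLp_top_of_bound (hz.snd.snd.indicator hB.compl).aestronglyMeasurable (max M 0)
      (.of_forall fun t => ?_)
    by_cases ht : t ∈ B
    · simp [ht]
    · simpa [ht] using .inl ((norm_snd_le (z t).2).trans (hbound t ht))
  · intro t ht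
    simp [ht]
  · filter_upwards [hzK] with t ht htB
    simpa [htB] using ht

end ApproximateMultipliers

end CTProblem

/-! ### Assembly of the AKKT sequence -/

theorem mainTheorem1 {n p m : ℕ} (C : CTProblem n p m)
    (xbar : ℝ → EuclideanSpace ℝ (Fin n))
    (hH : ∃ r : ℝ, 0 < r ∧ C.H1 xbar r ∧ C.H2 xbar r)
    (hopt : C.IsLocalOptimal xbar) :
    C.IsPwAKKT xbar := by
  obtain ⟨r, hr, h1, h2⟩ := hH
  obtain ⟨c, hc, hcb⟩ := h1.exists_bound_gradient hr
  have hε : ∀ k : ℕ, (0 : ℝ) < 1 / ((k : ℝ) + 1) := fun k => Nat.one_div_pos_of_nat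
  have hε1 : ∀ k : ℕ, 1 / ((k : ℝ) + 1) ≤ 1 := fun k => by
    rw [div_le_one (by positivity)]; linarith [(Nat.cast_nonneg k : (0 : ℝ) ≤ k)]
  have hε0 : Tendsto (fun k : ℕ => 1 / ((k : ℝ) + 1)) atTop (𝓝 0) :=
    tendsto_one_div_add_atTop_nhds_zero_nat
  obtain ⟨η, hη, hηsum⟩ := ENNReal.exists_pos_sum_of_countable' one_ne_zero ℕ
  choose x u v B hx hu hv hB hBz hK using fun k : ℕ =>
    hopt.exists_bounded_isKKTUpTo hr h1 h2 (hε k) (hη k)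
  have hBC : ∀ᵐ t ∂C.μ, ∀ᶠ k in atTop, t ∉ B k :=
    ae_eventually_notMem ((ENNReal.tsum_le_tsum fun k => (hB k).le).trans_lt
      (hηsum.trans ENNReal.one_lt_top)).ne
  have hKall := ae_all_iff.2 hK
  have hgm : ∀ k, AEMeasurable (fun t => C.gradLagrangian (x k t) (u k t) (v k t) t) C.μ :=
    fun k => CTProblem.aemeasurable_gradLagrangian_comp h1 h2 (hx k).aestronglyMeasurable.aemeasurable
      (hu k).aestronglyMeasurable.aemeasurable (hv k).aestronglyMeasurable.aemeasurable
  -- One dominating function for all `k`: off `B k` the gradient has norm at most `1 / (k + 1) ≤ 1`,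
  -- and on `B k` at most `c t`.
  have hgb : ∀ k, ∀ᵐ t ∂C.μ, ‖C.gradLagrangian (x k t) (u k t) (v k t) t‖ ≤ 1 + c t := by
    intro k
    filter_upwards [hK k, hcb] with t ht hct
    by_cases htB : t ∈ B k
    · obtain ⟨e1, e2, e3⟩ := hBz k t htB
      rw [e1, e2, e3, CTProblem.gradLagrangian_zero]
      linarith [hct.2]
    · linarith [(ht htB).norm_grad_le, hε1 k, hct.1]
  have hbi : Integrable (fun t => 1 + c t) C.μ := (integrable_const 1).add hc
  refine ⟨hopt.1, x, u, v, ⟨hx, hu, hv, fun k => ?_, fun γ hγ => ?_, fun j => ?_,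
    fun k j => ?_⟩, ?_⟩
  · exact hbi.mono' (hgm k).aestronglyMeasurable (hgb k)
  · obtain ⟨D, hD⟩ : ∃ D : ℝ, ∀ᵐ t ∂C.μ, ‖γ t‖ ≤ D :=
      ⟨_, ae_le_lpNorm_exponent_top hγ⟩
    have hlim : ∀ᵐ t ∂C.μ, Tendsto (fun k =>
        inner ℝ (C.gradLagrangian (x k t) (u k t) (v k t) t) (γ t)) atTop (𝓝 0) := by
      filter_upwards [hBC, hKall] with t htB ht
      have hg0 : Tendsto (fun k => C.gradLagrangian (x k t) (u k t) (v k t) t) atTop (𝓝 0) :=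
        squeeze_zero_norm' (htB.mono fun k hk => (ht k hk).norm_grad_le) hε0
      simpa using hg0.inner (tendsto_const_nhds (x := γ t))
    have := tendsto_integral_of_dominated_convergence (fun t => (1 + c t) * D)
      (fun k => ((hgm k).aestronglyMeasurable.inner hγ.aestronglyMeasurable))
      (hbi.mul_const D) (fun k => ?_) hlim
    · simpa using this
    · filter_upwards [hgb k, hD] with t h1 h2
      exact (norm_inner_le_norm _ _).trans
        (mul_le_mul h1 h2 (norm_nonneg _) ((norm_nonneg _).trans h1))
  · filter_upwards [hBC, hKall] with t htB ht
    refine squeeze_zero' ?_ (htB.mono fun k hk => (ht k hk).compl_le j) hε0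
    exact htB.mono fun k hk => mul_nonneg ((ht k hk).nonneg j) (le_max_right _ _)
  · filter_upwards [hK k] with t ht
    by_cases htB : t ∈ B k
    · simp [(hBz k t htB).2.2]
    · exact (ht htB).nonneg j
  · filter_upwards [hBC, hKall] with t htB ht
    rw [tendsto_iff_norm_sub_tendsto_zero]
    exact squeeze_zero' (.of_forall fun k => norm_nonneg _)
      (htB.mono fun k hk => (ht k hk).norm_sub_le) hε0
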